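/- Let $\mu_1,\dots,\mu_p\in\mathbb{R}^N$, let $\Sigma_1,\dots,\Sigma_q\in\mathbb{R}^{N\times N}$ be symmetric positive definite, $a\in\mathbb{R}^p$, $b\in\mathbb{R}^q$, and $\mathcal{W}=\{w\in\mathbb{R}^N: w\ge 0,\ \mathbf{1}^{\mathsf T}w=1\}$. Put $x_i(w)=w^{\mathsf T}\mu_i$, $y_j(w)=w^{\mathsf T}\Sigma_j w$, $g(w)=[a-x(w);\,y(w)-b]\in\mathbb{R}^{p+q}$ and $\mathcal{K}=\{w\in\mathcal{W}: g(w)\le 0\}$, and suppose that some $w\in\mathcal{W}$ satisfies $g(w)<0$ in every component. Let $F:\mathbb{R}^p\times\mathbb{R}^q\to\mathbb{R}$ be differentiable at $(x(w),y(w))$ for every $w\in\mathcal{K}$, and assume (Assumption 1) that, on the points $(x(w),y(w))$ with $w\in\mathcal{K}$, each partial derivative $\nabla_{x_i}F$ that is not identically $0$ is everywhere negative and each $\nabla_{y_j}F$ that is not identically $0$ is everywhere positive. Fix $w^k\in\mathcal{K}$, let $x^k=x(w^k)$, $y^k=y(w^k)$, $\lambda^k=[-\nabla_xF(x^k,y^k);\,\nabla_yF(x^k,y^k)]$,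 and consider the convexified subproblem $$\min_{w\in\mathcal{K}}\ \tilde f(w;w^k)=\nabla_xF(x^k,y^k)^{\mathsf T}x(w)+\nabla_yF(x^k,y^k)^{\mathsf T}y(w).\qquad(\ast)$$ For $\eta=[\eta_x;\eta_y]\ge 0$ let $h(\eta;\lambda^k)=\inf_{w\in\mathcal{W}}\{\tilde f(w;w^k)+\eta^{\mathsf T}g(w)\}$ and let $\hat w(\lambda^k,\eta)$ denote a solution of the quadratic program $\min_{w\in\mathcal{W}}\ -(\lambda^k_x+\eta_x)^{\mathsf T}x(w)+(\lambda^k_y+\eta_y)^{\mathsf T}y(w)$. Let $\alpha^{\mathrm{init}}>0$, $\sigma,\beta\in(0,1)$, $\eta^0\ge 0$, and for $l=0,1,\dots$ let $$\eta^{l+1}=\big[\eta^l+\alpha^l g(\hat w(\lambda^k,\eta^l))\big]_+,$$ where $\alpha^l$ is chosen by the Armijo rule along the projection arc, i.e. $\alpha^l$ is the largest element of $\{\alpha^{\mathrm{init}}\beta^j\}_{j=0,1,\dots}$ for which $$h(\eta^{l+1};\lambda^k)-h(\eta^l;\lambda^k)\ \ge\ \sigma\, g(\hat w(\lambda^k,\eta^l))^{\mathsf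 T}(\eta^{l+1}-\eta^l).$$ Suppose that the quadratic program has a unique solution at every iterate $\eta=\eta^l$ and at every limit point $\eta$ of $\{\eta^l\}$ (this is automatic if some component of $\nabla_yF(x^k,y^k)$ is nonzero). Then the subproblem $(\ast)$ has a unique optimal solution, and the sequence $\hat w(\lambda^k,\eta^l)$, $l=1,2,\dots$, converges to it. -/

import Mathlib

open Filter Topology
open scoped Matrix

noncomputable section

/-- Data of a general mean-variance portfolio problem with `N` assets, `p` mean estimates and
`q` covariance estimates: minimize `F (x(w), y(w))` over the budget simplex subject to
`a i ≤ x i (w)` and `y j (w) ≤ b j`. -/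
structure MVP (N p q : ℕ) where
  /-- mean vectors -/
  μ : Fin p → Fin N → ℝ
  /-- covariance matrices -/
  S : Fin q → Matrix (Fin N) (Fin N) ℝ
  /-- lower limits on the expected returns -/
  a : Fin p → ℝ
  /-- upper limits on the risks -/
  b : Fin q → ℝ
  /-- objective as a function of means and variances -/
  F : (Fin p → ℝ) × (Fin q → ℝ) → ℝ

namespace MVP

variable {N p q : ℕ} (P : MVP N p q)

/-- Expected returns `x_i(w) = wᵀ μ_i`. -/
def x (w : Fin N → ℝ) : Fin p → ℝ := fun i => w ⬝ᵥ P.μ i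

/-- Risks `y_j(w) = wᵀ Σ_j w`. -/
def y (w : Fin N → ℝ) : Fin q → ℝ := fun j => w ⬝ᵥ (P.S j *ᵥ w)

/-- The set of long-only portfolios with unit budget. -/
def W (_P : MVP N p q) : Set (Fin N → ℝ) := {w | (∀ i, 0 ≤ w i) ∧ ∑ i, w i = 1}

/-- The feasible set. -/
def K : Set (Fin N → ℝ) :=
  {w | w ∈ P.W ∧ (∀ i, P.a i ≤ P.x w i) ∧ (∀ j, P.y w j ≤ P.b j)}

/-- Points of the simplex at which all mean-variance constraints hold strictly. -/
def IsStrictlyFeasible (w : Fin N → ℝ) : Prop :=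
  w ∈ P.W ∧ (∀ i, P.a i < P.x w i) ∧ (∀ j, P.y w j < P.b j)

/-- The compact constraint function `g(w) = [a - x(w); y(w) - b]`. -/
def g (w : Fin N → ℝ) : Fin p ⊕ Fin q → ℝ :=
  Sum.elim (fun i => P.a i - P.x w i) (fun j => P.y w j - P.b j)

/-- The partial derivative of `F` in `x_i`, at `(x(w), y(w))`. -/
def dFx (w : Fin N → ℝ) (i : Fin p) : ℝ :=
  fderiv ℝ P.F (P.x w, P.y w) (Pi.single i 1, 0)

/-- The partial derivative of `F` in `y_j`, at `(x(w), y(w))`. -/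
def dFy (w : Fin N → ℝ) (j : Fin q) : ℝ :=
  fderiv ℝ P.F (P.x w, P.y w) (0, Pi.single j 1)

/-- `x_i` exists in `F`: its partial derivative does not always vanish. -/
def XExists (i : Fin p) : Prop := ∃ w ∈ P.K, P.dFx w i ≠ 0

/-- `y_j` exists in `F`: its partial derivative does not always vanish. -/
def YExists (j : Fin q) : Prop := ∃ w ∈ P.K, P.dFy w j ≠ 0

/-- Rational risk-return trade-off: `F` has negative partial derivatives in the means and positive
ones in the variances that exist in it. -/
def RationalTradeoff : Prop :=
  (∀ i, P.XExists i → ∀ w ∈ P.K, P.dFx w i < 0) ∧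
  (∀ j, P.YExists j → ∀ w ∈ P.K, 0 < P.dFy w j)

/-- The convexified objective `f̃(w; wk) = ∇ₓF(xᵏ, yᵏ)ᵀ x(w) + ∇_yF(xᵏ, yᵏ)ᵀ y(w)`. -/
def fTilde (wk w : Fin N → ℝ) : ℝ := P.dFx wk ⬝ᵥ P.x w + P.dFy wk ⬝ᵥ P.y w

/-- `w` is an optimal solution of the convexified subproblem: minimize `f̃(·; wk)` over `K`. -/
def IsSubproblemSolution (wk w : Fin N → ℝ) : Prop :=
  w ∈ P.K ∧ IsMinOn (P.fTilde wk) P.K w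

/-- The weights `λᵏ = [-∇ₓF(xᵏ, yᵏ); ∇_yF(xᵏ, yᵏ)]`. -/
def lam (wk : Fin N → ℝ) : Fin p ⊕ Fin q → ℝ :=
  Sum.elim (fun i => -P.dFx wk i) (fun j => P.dFy wk j)

/-- Objective of the QP surrogate problem,
`-(λₓ + ηₓ)ᵀ x(w) + (λ_y + η_y)ᵀ y(w)`. -/
def qpObjective (lam η : Fin p ⊕ Fin q → ℝ) (w : Fin N → ℝ) : ℝ :=
  -(∑ i : Fin p, (lam (Sum.inl i) + η (Sum.inl i)) * P.x w i)
    + ∑ j : Fin q, (lam (Sum.inr j) + η (Sum.inr j)) * P.y w j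

/-- `w` solves the QP surrogate problem with weights `lam` and `η`. -/
def IsQPSolution (lam η : Fin p ⊕ Fin q → ℝ) (w : Fin N → ℝ) : Prop :=
  w ∈ P.W ∧ IsMinOn (P.qpObjective lam η) P.W w

/-- Partial Lagrangian of the convexified subproblem,
`f̃(w; wk) - ηₓᵀ (x(w) - a) + η_yᵀ (y(w) - b)`. -/
def lagrangian (wk w : Fin N → ℝ) (η : Fin p ⊕ Fin q → ℝ) : ℝ :=
  P.fTilde wk w - ∑ i : Fin p, η (Sum.inl i) * (P.x w i - P.a i)
    + ∑ j : Fin q, η (Sum.inr j) * (P.y w j - P.b j)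

/-- Lagrangian dual function `h(η; λᵏ)`, the infimum of the partial Lagrangian over the simplex. -/
def dual (wk : Fin N → ℝ) (η : Fin p ⊕ Fin q → ℝ) : ℝ :=
  sInf ((fun w => P.lagrangian wk w η) '' P.W)

/-- The projection arc `[η + α g(w)]₊`. -/
def arc (η : Fin p ⊕ Fin q → ℝ) (w : Fin N → ℝ) (α : ℝ) : Fin p ⊕ Fin q → ℝ :=
  fun c => max 0 (η c + α * P.g w c)

/-- The sufficient-increase test of the Armijo rule along the projection arc. -/
def ArmijoTest (wk : Fin N → ℝ) (σ : ℝ) (η : Fin p ⊕ Fin q → ℝ) (w : Fin N → ℝ) (α : ℝ) : Prop :=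
  P.dual wk (P.arc η w α) - P.dual wk η ≥ σ * (P.g w ⬝ᵥ (P.arc η w α - η))

/-- A run of the inner loop at the outer iterate `wk`: multipliers `η l`, step sizes `α l` and QP
solutions `wHat l`, with the Armijo rule along the projection arc. -/
structure IsInnerLoop (wk : Fin N → ℝ) (αinit σ β : ℝ)
    (η : ℕ → Fin p ⊕ Fin q → ℝ) (α : ℕ → ℝ) (wHat : ℕ → Fin N → ℝ) : Prop where
  /-- the initial multipliers are nonnegative -/
  init : ∀ c, 0 ≤ η 0 c
  /-- `wHat l` solves the QP surrogate problem with weights `λᵏ` and `η l` -/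
  qp : ∀ l, P.IsQPSolution (P.lam wk) (η l) (wHat l)
  /-- `α l` is the largest of the numbers `αinit * β ^ j` passing the Armijo test -/
  armijo : ∀ l, IsGreatest
    {t : ℝ | (∃ j : ℕ, t = αinit * β ^ j) ∧ P.ArmijoTest wk σ (η l) (wHat l) t} (α l)
  /-- projected gradient step -/
  update : ∀ l, η (l + 1) = P.arc (η l) (wHat l) (α l)

end MVP

end

/-!
The iteration is projected gradient ascent on the dual function: the constraint values at a
minimizer of the Lagrangian are a supergradient of the concave dual, and where the minimizer is
unique it depends continuously on the multipliers.

The dual values increase and, by weak duality, are bounded, so the Armijo rule forces the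
first-order gain of the steps to `0`; the Slater point bounds the multipliers. At a limit `ζ` of
multipliers the gain along the projection arc vanishes. This is immediate if the steps stay away
from `0`. If they tend to `0`, the previous trial steps failed the Armijo test, and by continuity of
the minimizer such failures are incompatible with a positive gain at the limit. Zero gain says that
the minimizer `v` of the Lagrangian at `ζ` is feasible and complementary to `ζ`, so `v` solves the
program, and every solution minimizes the Lagrangian at `ζ`, hence equals `v`. All limits of the
minimizers thus coincide, and compactness gives convergence.
-/

section ProjectionArc

section Scalar

variable {R : Type*} [CommRing R] [LinearOrder R] [IsStrictOrderedRing R] {e g s t : R}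

theorem mul_posPart_add_mul_sub_nonneg (he : 0 ≤ e) (ht : 0 ≤ t) :
    0 ≤ g * ((e + t * g)⁺ - e) := by
  rcases le_total 0 g with hg | hg
  · have htg : 0 ≤ t * g := mul_nonneg ht hg
    exact mul_nonneg hg (by linarith [le_posPart (e + t * g)])
  · have htg : t * g ≤ 0 := mul_nonpos_of_nonneg_of_nonpos ht hg
    exact mul_nonneg_of_nonpos_of_nonpos hg (sub_nonpos.2 (sup_le (by linarith) he))

theorem abs_posPart_add_mul_sub_le (he : 0 ≤ e) (ht : 0 ≤ t) :
    |(e + t * g)⁺ - e| ≤ t * |g| :=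
  calc |(e + t * g)⁺ - e| = |max (e + t * g) 0 - max e 0| := by rw [posPart_def, max_eq_left he]
    _ ≤ |e + t * g - e| := abs_max_sub_max_le_abs _ _ _
    _ = t * |g| := by rw [add_sub_cancel_left, abs_mul, abs_of_nonneg ht]

theorem mul_posPart_add_mul_sub_le (he : 0 ≤ e) (hs : 0 ≤ s) (hst : s ≤ t) :
    s * (g * ((e + t * g)⁺ - e)) ≤ t * (g * ((e + s * g)⁺ - e)) := by
  have ht : 0 ≤ t := hs.trans hst
  rcases le_total 0 g with hg | hg
  · rw [posPart_of_nonneg (add_nonneg he (mul_nonneg ht hg)),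
      posPart_of_nonneg (add_nonneg he (mul_nonneg hs hg))]
    exact le_of_eq (by ring)
  · have displacement_le : t * ((e + s * g)⁺ - e) ≤ s * ((e + t * g)⁺ - e) := by
      rcases le_total 0 (e + s * g) with h | h
      · rw [posPart_of_nonneg h]
        linarith [mul_le_mul_of_nonneg_left (le_posPart (e + t * g)) hs]
      · rw [posPart_of_nonpos h]
        linarith [mul_nonneg hs (posPart_nonneg (e + t * g)), mul_le_mul_of_nonneg_right hst he]
    linarith [mul_le_mul_of_nonpos_left displacement_le hg]

theorem nonpos_and_mul_eq_zero_of_mul_posPart_eq_zero (he : 0 ≤ e) (ht : 0 < t)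
    (h : g * ((e + t * g)⁺ - e) = 0) : g ≤ 0 ∧ e * g = 0 := by
  rcases mul_eq_zero.1 h with rfl | hfixed
  · simp
  rcases le_total 0 (e + t * g) with hpos | hneg
  · rw [posPart_of_nonneg hpos, add_sub_cancel_left] at hfixed
    simp [(mul_eq_zero.1 hfixed).resolve_left ht.ne']
  · rw [posPart_of_nonpos hneg, zero_sub, neg_eq_zero] at hfixed
    subst hfixed
    exact ⟨nonpos_of_mul_nonpos_right (by simpa using hneg) ht, zero_mul _⟩

end Scalar

/-- The first-order increase `gᵀ(e(t) - e)` along the projection arc `e(t) = [e + t g]₊` of the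
nonnegative orthant, as it occurs in the Armijo rule. For `0 ≤ e` and `0 < t` it vanishes exactly
when `e` is stationary for the ascent direction `g`. -/
def arcGain {R ι : Type*} [Ring R] [Lattice R] [Fintype ι] (e g : ι → R) (t : R) : R :=
  g ⬝ᵥ ((e + t • g)⁺ - e)

variable {R ι : Type*} [CommRing R] [LinearOrder R] [IsStrictOrderedRing R] [Fintype ι]
  {e g : ι → R} {s t : R}

theorem arcGain_nonneg (he : 0 ≤ e) (ht : 0 ≤ t) : 0 ≤ arcGain e g t :=
  Finset.sum_nonneg fun c _ => mul_posPart_add_mul_sub_nonneg (he c) ht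

theorem mul_arcGain_le_mul_arcGain (he : 0 ≤ e) (hs : 0 ≤ s) (hst : s ≤ t) :
    s * arcGain e g t ≤ t * arcGain e g s := by
  simp only [arcGain, dotProduct, Finset.mul_sum]
  exact Finset.sum_le_sum fun c _ => mul_posPart_add_mul_sub_le (he c) hs hst

theorem nonpos_and_dotProduct_eq_zero_of_arcGain_eq_zero (he : 0 ≤ e) (ht : 0 < t)
    (h : arcGain e g t = 0) : g ≤ 0 ∧ e ⬝ᵥ g = 0 := by
  have hterm := (Finset.sum_eq_zero_iff_of_nonneg fun c _ =>
    mul_posPart_add_mul_sub_nonneg (g := g c) (he c) ht.le).1 h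
  have hcompl c := nonpos_and_mul_eq_zero_of_mul_posPart_eq_zero (he c) ht
    (hterm c (Finset.mem_univ c))
  exact ⟨fun c => (hcompl c).1, Finset.sum_eq_zero fun c _ => (hcompl c).2⟩

theorem dotProduct_posPart_add_smul_sub_le (he : 0 ≤ e) (ht : 0 ≤ t) (d : ι → R) :
    d ⬝ᵥ ((e + t • g)⁺ - e) ≤ t * (|d| ⬝ᵥ |g|) := by
  rw [dotProduct, dotProduct, Finset.mul_sum]
  refine Finset.sum_le_sum fun c _ => ?_
  calc d c * ((e c + t * g c)⁺ - e c) ≤ |d c| * |(e c + t * g c)⁺ - e c| := by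
        rw [← abs_mul]; exact le_abs_self _
    _ ≤ |d c| * (t * |g c|) := by gcongr; exact abs_posPart_add_mul_sub_le (he c) ht
    _ = t * (|d c| * |g c|) := mul_left_comm _ _ _

end ProjectionArc

section Limits

theorem mem_closure_range_of_mapClusterPt {X Y : Type*} [TopologicalSpace X] {l : Filter Y}
    {u : Y → X} {x : X} (h : MapClusterPt x l u) : x ∈ closure (Set.range u) :=
  mem_closure_iff_clusterPt.2 (h.clusterPt.mono (le_principal_iff.2 range_mem_map))

variable {ι κ : Type*} {l : Filter κ}

theorem tendsto_abs_pi {u : κ → ι → ℝ} {u₀ : ι → ℝ} (hu : Tendsto u l (𝓝 u₀)) :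
    Tendsto (fun k => |u k|) l (𝓝 |u₀|) :=
  tendsto_pi_nhds.2 fun c => (tendsto_pi_nhds.1 hu c).abs

theorem tendsto_posPart_add_smul {e g : κ → ι → ℝ} {t : κ → ℝ} {e₀ g₀ : ι → ℝ} {t₀ : ℝ}
    (he : Tendsto e l (𝓝 e₀)) (hg : Tendsto g l (𝓝 g₀)) (ht : Tendsto t l (𝓝 t₀)) :
    Tendsto (fun k => (e k + t k • g k)⁺) l (𝓝 (e₀ + t₀ • g₀)⁺) :=
  tendsto_pi_nhds.2 fun c => (continuous_posPart.tendsto _).comp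
    ((tendsto_pi_nhds.1 he c).add (ht.mul (tendsto_pi_nhds.1 hg c)))

variable [Fintype ι]

theorem tendsto_dotProduct {u v : κ → ι → ℝ} {u₀ v₀ : ι → ℝ} (hu : Tendsto u l (𝓝 u₀))
    (hv : Tendsto v l (𝓝 v₀)) : Tendsto (fun k => u k ⬝ᵥ v k) l (𝓝 (u₀ ⬝ᵥ v₀)) :=
  ((continuous_fst.dotProduct continuous_snd).tendsto (u₀, v₀)).comp (hu.prodMk_nhds hv)

theorem tendsto_arcGain {e g : κ → ι → ℝ} {t : κ → ℝ} {e₀ g₀ : ι → ℝ} {t₀ : ℝ}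
    (he : Tendsto e l (𝓝 e₀)) (hg : Tendsto g l (𝓝 g₀)) (ht : Tendsto t l (𝓝 t₀)) :
    Tendsto (fun k => arcGain (e k) (g k) (t k)) l (𝓝 (arcGain e₀ g₀ t₀)) :=
  tendsto_dotProduct hg ((tendsto_posPart_add_smul he hg ht).sub he)

end Limits

/-- The program of minimizing `objective w` over the `w ∈ domain` with `constraint w ≤ 0`, where
the domain is compact and the data are continuous on it. The domain is the part of the feasible set
that is not dualized. -/
structure CompactProgram (E ι : Type*) [TopologicalSpace E] where
  /-- the set over which the Lagrangian is minimized -/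
  domain : Set E
  /-- the function to be minimized -/
  objective : E → ℝ
  /-- the functions required to be nonpositive -/
  constraint : E → ι → ℝ
  isCompact_domain : IsCompact domain
  continuousOn_objective : ContinuousOn objective domain
  continuousOn_constraint : ContinuousOn constraint domain

namespace CompactProgram

variable {E ι κ : Type*} [TopologicalSpace E] (Q : CompactProgram E ι)

/-- The points of the domain that satisfy the constraints. -/
def feasibleSet : Set E := {w | w ∈ Q.domain ∧ Q.constraint w ≤ 0}

/-- `w` is an optimal solution of the program. -/
def IsSolution (w : E) : Prop :=
  w ∈ Q.feasibleSet ∧ IsMinOn Q.objective Q.feasibleSet w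

theorem tendsto_constraint {Q : CompactProgram E ι} {l : Filter κ} {wSeq : κ → E} {v : E}
    (hw : Tendsto wSeq l (𝓝[Q.domain] v)) (hv : v ∈ Q.domain) :
    Tendsto (fun k => Q.constraint (wSeq k)) l (𝓝 (Q.constraint v)) :=
  (Q.continuousOn_constraint v hv).tendsto.comp hw

variable [Fintype ι]

/-- The partial Lagrangian `f + ηᵀ g`, in which the constraint `w ∈ domain` is not dualized. -/
def lagrangian (η : ι → ℝ) (w : E) : ℝ := Q.objective w + η ⬝ᵥ Q.constraint w

/-- `w` minimizes the Lagrangian at `η` over the domain, i.e. attains the dual function at `η`. -/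
def IsLagrangianMin (η : ι → ℝ) (w : E) : Prop :=
  w ∈ Q.domain ∧ IsMinOn (Q.lagrangian η) Q.domain w

/-- The Lagrangian dual function. By compactness the infimum is attained, so that `sInf` is the
genuine infimum whenever the domain is nonempty. -/
noncomputable def dual (η : ι → ℝ) : ℝ := sInf (Q.lagrangian η '' Q.domain)

variable {Q}

section Duality

variable {η : ι → ℝ} {v w : E}

theorem continuousOn_lagrangian (η : ι → ℝ) : ContinuousOn (Q.lagrangian η) Q.domain :=
  Q.continuousOn_objective.add
    ((continuous_const.dotProduct continuous_id).comp_continuousOn Q.continuousOn_constraint)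

theorem exists_isLagrangianMin (hQ : Q.domain.Nonempty) (η : ι → ℝ) :
    ∃ w, Q.IsLagrangianMin η w :=
  Q.isCompact_domain.exists_isMinOn hQ (continuousOn_lagrangian η)

theorem IsLagrangianMin.dual_eq (h : Q.IsLagrangianMin η w) : Q.dual η = Q.lagrangian η w :=
  IsLeast.csInf_eq ⟨Set.mem_image_of_mem _ h.1, Set.forall_mem_image.2 h.2⟩

theorem dual_le_lagrangian (hv : v ∈ Q.domain) (η : ι → ℝ) : Q.dual η ≤ Q.lagrangian η v := by
  obtain ⟨w, hw⟩ := exists_isLagrangianMin ⟨v, hv⟩ η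
  exact hw.dual_eq.trans_le (hw.2 hv)

theorem lagrangian_le_objective (hη : 0 ≤ η) (hv : Q.constraint v ≤ 0) :
    Q.lagrangian η v ≤ Q.objective v :=
  add_le_of_nonpos_right <| Finset.sum_nonpos fun c _ =>
    mul_nonpos_of_nonneg_of_nonpos (hη c) (hv c)

theorem dual_le_objective (hη : 0 ≤ η) (hv : v ∈ Q.feasibleSet) : Q.dual η ≤ Q.objective v :=
  (dual_le_lagrangian hv.1 η).trans (lagrangian_le_objective hη hv.2)

theorem IsLagrangianMin.dual_le_add (h : Q.IsLagrangianMin η w) (ζ : ι → ℝ) :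
    Q.dual ζ ≤ Q.dual η + Q.constraint w ⬝ᵥ (ζ - η) :=
  calc Q.dual ζ ≤ Q.lagrangian ζ w := dual_le_lagrangian h.1 ζ
    _ = Q.lagrangian η w + Q.constraint w ⬝ᵥ (ζ - η) := by
        rw [lagrangian, lagrangian, dotProduct_comm _ (ζ - η), sub_dotProduct]; ring
    _ = Q.dual η + Q.constraint w ⬝ᵥ (ζ - η) := by rw [h.dual_eq]

theorem le_div_of_constraint_neg (hη : 0 ≤ η) (hw : w ∈ Q.domain)
    (hneg : ∀ c, Q.constraint w c < 0) (c : ι) :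
    η c ≤ (Q.objective w - Q.dual η) / -Q.constraint w c := by
  have hsum : η c * -Q.constraint w c ≤ ∑ c, η c * -Q.constraint w c :=
    Finset.single_le_sum (f := fun c => η c * -Q.constraint w c)
      (fun c _ => mul_nonneg (hη c) (neg_nonneg.2 (hneg c).le)) (Finset.mem_univ c)
  have hdual := dual_le_lagrangian hw η
  simp only [mul_neg, Finset.sum_neg_distrib] at hsum
  rw [lagrangian, dotProduct] at hdual
  rw [le_div_iff₀ (neg_pos.2 (hneg c))]
  linarith

theorem IsLagrangianMin.isSolution (h : Q.IsLagrangianMin η w) (hη : 0 ≤ η)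
    (hfeas : Q.constraint w ≤ 0) (hcompl : η ⬝ᵥ Q.constraint w = 0) : Q.IsSolution w := by
  refine ⟨⟨h.1, hfeas⟩, fun v hv => ?_⟩
  calc Q.objective w = Q.lagrangian η w := by rw [lagrangian, hcompl, add_zero]
    _ ≤ Q.lagrangian η v := h.2 hv.1
    _ ≤ Q.objective v := lagrangian_le_objective hη hv.2

theorem IsSolution.isLagrangianMin (hv : Q.IsSolution v) (h : Q.IsLagrangianMin η w) (hη : 0 ≤ η)
    (hfeas : Q.constraint w ≤ 0) (hcompl : η ⬝ᵥ Q.constraint w = 0) : Q.IsLagrangianMin η v := by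
  refine ⟨hv.1.1, fun u hu => ?_⟩
  calc Q.lagrangian η v ≤ Q.objective v := lagrangian_le_objective hη hv.1.2
    _ ≤ Q.objective w := hv.2 ⟨h.1, hfeas⟩
    _ = Q.lagrangian η w := by rw [lagrangian, hcompl, add_zero]
    _ ≤ Q.lagrangian η u := h.2 hu

end Duality

section Continuity

variable {l : Filter κ} {ηSeq : κ → ι → ℝ} {ζ : ι → ℝ} {wSeq : κ → E} {v : E}

theorem tendsto_lagrangian (hη : Tendsto ηSeq l (𝓝 ζ)) (hw : Tendsto wSeq l (𝓝[Q.domain] v))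
    (hv : v ∈ Q.domain) :
    Tendsto (fun k => Q.lagrangian (ηSeq k) (wSeq k)) l (𝓝 (Q.lagrangian ζ v)) :=
  ((Q.continuousOn_objective v hv).tendsto.comp hw).add
    (tendsto_dotProduct hη (tendsto_constraint hw hv))

theorem isLagrangianMin_of_tendsto [l.NeBot] (hmin : ∀ k, Q.IsLagrangianMin (ηSeq k) (wSeq k))
    (hη : Tendsto ηSeq l (𝓝 ζ)) (hw : Tendsto wSeq l (𝓝 v)) (hv : v ∈ Q.domain) :
    Q.IsLagrangianMin ζ v := by
  have hw' : Tendsto wSeq l (𝓝[Q.domain] v) :=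
    tendsto_nhdsWithin_iff.2 ⟨hw, .of_forall fun k => (hmin k).1⟩
  refine ⟨hv, fun u hu => ?_⟩
  have hu' : Tendsto (fun _ : κ => u) l (𝓝[Q.domain] u) :=
    tendsto_nhdsWithin_iff.2 ⟨tendsto_const_nhds, .of_forall fun _ => hu⟩
  exact le_of_tendsto_of_tendsto' (tendsto_lagrangian hη hw' hv) (tendsto_lagrangian hη hu' hu)
    fun k => (hmin k).2 hu

theorem tendsto_of_isLagrangianMin (hmin : ∀ k, Q.IsLagrangianMin (ηSeq k) (wSeq k))
    (hη : Tendsto ηSeq l (𝓝 ζ)) (huniq : ∀ u, Q.IsLagrangianMin ζ u → u = v) :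
    Tendsto wSeq l (𝓝[Q.domain] v) := by
  have hmem : ∀ k, wSeq k ∈ Q.domain := fun k => (hmin k).1
  refine tendsto_nhdsWithin_iff.2 ⟨?_, .of_forall hmem⟩
  refine Q.isCompact_domain.tendsto_nhds_of_unique_mapClusterPt (.of_forall hmem) fun u hu hcl => ?_
  obtain ⟨U, hU, hwU⟩ := mapClusterPt_iff_ultrafilter.1 hcl
  exact huniq u (isLagrangianMin_of_tendsto hmin (hη.mono_left hU) hwU hu)

end Continuity

section Armijo

variable {η ζ : ι → ℝ} {v w : E} {σ s t : ℝ} {l : Filter κ} {ηSeq : κ → ι → ℝ} {wSeq : κ → E}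

/-- The sufficient-increase test for the step `t` along the projection arc `[η + t g(w)]₊`. -/
def ArmijoTest (Q : CompactProgram E ι) (σ : ℝ) (η : ι → ℝ) (w : E) (t : ℝ) : Prop :=
  σ * arcGain η (Q.constraint w) t ≤ Q.dual (η + t • Q.constraint w)⁺ - Q.dual η

-- The supergradient inequality is used at the end of the arc, not at its start: there it turns the
-- failure of the test into a bound by the variation of the constraint values between the two ends.
theorem arcGain_le_of_not_armijoTest (hη : 0 ≤ η) (hs : 0 < s) (hst : s ≤ t) (hσ : σ ≤ 1)
    (hv : Q.IsLagrangianMin (η + s • Q.constraint w)⁺ v) (hfail : ¬Q.ArmijoTest σ η w s) :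
    (1 - σ) * arcGain η (Q.constraint w) t ≤
      t * (|Q.constraint w - Q.constraint v| ⬝ᵥ |Q.constraint w|) := by
  set G := Q.constraint w
  set V := |G - Q.constraint v| ⬝ᵥ |G|
  have gain_le : (1 - σ) * arcGain η G s ≤ s * V := by
    refine le_trans ?_ (dotProduct_posPart_add_smul_sub_le hη hs.le (G - Q.constraint v))
    have hsup := hv.dual_le_add η
    rw [← neg_sub, dotProduct_neg] at hsup
    rw [ArmijoTest, not_le] at hfail
    rw [sub_dotProduct, ← arcGain]
    linarith
  refine le_of_mul_le_mul_left ?_ hs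
  calc s * ((1 - σ) * arcGain η G t) = (1 - σ) * (s * arcGain η G t) := by ring
    _ ≤ (1 - σ) * (t * arcGain η G s) :=
        mul_le_mul_of_nonneg_left (mul_arcGain_le_mul_arcGain hη hs.le hst) (sub_nonneg.2 hσ)
    _ = t * ((1 - σ) * arcGain η G s) := by ring
    _ ≤ t * (s * V) := mul_le_mul_of_nonneg_left gain_le (hs.le.trans hst)
    _ = s * (t * V) := by ring

theorem arcGain_eq_zero_of_not_armijoTest [l.NeBot] {sSeq : κ → ℝ}
    (hη : Tendsto ηSeq l (𝓝 ζ)) (hη0 : ∀ k, 0 ≤ ηSeq k)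
    (hw : Tendsto wSeq l (𝓝[Q.domain] v)) (hv : v ∈ Q.domain)
    (huniq : ∀ u, Q.IsLagrangianMin ζ u → u = v)
    (hs : Tendsto sSeq l (𝓝 0)) (hs0 : ∀ k, 0 < sSeq k) (hσ : σ < 1) (ht : 0 < t)
    (hfail : ∀ᶠ k in l, ¬Q.ArmijoTest σ (ηSeq k) (wSeq k) (sSeq k)) :
    arcGain ζ (Q.constraint v) t = 0 := by
  have hζ : 0 ≤ ζ := ge_of_tendsto' hη hη0
  have hg := tendsto_constraint hw hv
  choose u hu using fun k =>
    exists_isLagrangianMin ⟨v, hv⟩ (ηSeq k + sSeq k • Q.constraint (wSeq k))⁺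
  have hend : Tendsto (fun k => (ηSeq k + sSeq k • Q.constraint (wSeq k))⁺) l (𝓝 ζ) := by
    simpa [posPart_of_nonneg hζ] using tendsto_posPart_add_smul hη hg hs
  have hgu := tendsto_constraint (tendsto_of_isLagrangianMin hu hend huniq) hv
  have hvariation : Tendsto (fun k => t *
      (|Q.constraint (wSeq k) - Q.constraint (u k)| ⬝ᵥ |Q.constraint (wSeq k)|)) l (𝓝 0) := by
    simpa using (tendsto_dotProduct (tendsto_abs_pi (hg.sub hgu)) (tendsto_abs_pi hg)).const_mul t
  have hlim : (1 - σ) * arcGain ζ (Q.constraint v) t ≤ 0 := by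
    refine le_of_tendsto_of_tendsto ((tendsto_arcGain hη hg tendsto_const_nhds).const_mul _)
      hvariation ?_
    filter_upwards [hfail, hs.eventually_lt_const ht] with k hk hkt
    exact arcGain_le_of_not_armijoTest (hη0 k) (hs0 k) hkt.le hσ.le (hu k) hk
  exact le_antisymm (nonpos_of_mul_nonpos_right hlim (sub_pos.2 hσ)) (arcGain_nonneg hζ ht.le)

/-- A run of projected supergradient ascent on the dual function: multipliers `η l`, step sizes
`α l` chosen by the Armijo rule along the projection arc, and minimizers `w l` of the Lagrangian.
The conditions on the parameters of the Armijo rule are part of the notion. -/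
structure IsArmijoAscent (Q : CompactProgram E ι) (αinit σ β : ℝ) (η : ℕ → ι → ℝ) (α : ℕ → ℝ)
    (w : ℕ → E) : Prop where
  αinit_pos : 0 < αinit
  σ_mem : σ ∈ Set.Ioo (0 : ℝ) 1
  β_mem : β ∈ Set.Ioo (0 : ℝ) 1
  init : 0 ≤ η 0
  isLagrangianMin : ∀ l, Q.IsLagrangianMin (η l) (w l)
  armijo : ∀ l, IsGreatest
    {t : ℝ | (∃ j : ℕ, t = αinit * β ^ j) ∧ Q.ArmijoTest σ (η l) (w l) t} (α l)
  update : ∀ l, η (l + 1) = (η l + α l • Q.constraint (w l))⁺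

end Armijo

namespace IsArmijoAscent

variable {αinit σ β : ℝ} {η : ℕ → ι → ℝ} {α : ℕ → ℝ} {w : ℕ → E} {w₀ : E}

theorem nonneg (h : Q.IsArmijoAscent αinit σ β η α w) : ∀ l, 0 ≤ η l
  | 0 => h.init
  | l + 1 => h.update l ▸ posPart_nonneg _

theorem step_mem_Ioc (h : Q.IsArmijoAscent αinit σ β η α w) (l : ℕ) :
    α l ∈ Set.Ioc 0 αinit := by
  obtain ⟨j, hj⟩ := (h.armijo l).1.1
  rw [hj]
  exact ⟨mul_pos h.αinit_pos (pow_pos h.β_mem.1 j),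
    mul_le_of_le_one_right h.αinit_pos.le (pow_le_one₀ h.β_mem.1.le h.β_mem.2.le)⟩

theorem not_armijoTest_div (h : Q.IsArmijoAscent αinit σ β η α w) {l : ℕ} (hl : α l < αinit) :
    ¬Q.ArmijoTest σ (η l) (w l) (α l / β) := by
  intro htest
  obtain ⟨_ | j, hj⟩ := (h.armijo l).1.1
  · simp [hj] at hl
  · have hprev : α l / β = αinit * β ^ j := by
      rw [hj, pow_succ, ← mul_assoc, mul_div_cancel_right₀ _ h.β_mem.1.ne']
    have hlt : α l < α l / β :=
      (lt_div_iff₀ h.β_mem.1).2 (mul_lt_of_lt_one_right (h.step_mem_Ioc l).1 h.β_mem.2)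
    exact ((h.armijo l).2 ⟨⟨j, hprev⟩, htest⟩).not_gt hlt

theorem arcGain_step_nonneg (h : Q.IsArmijoAscent αinit σ β η α w) (l : ℕ) :
    0 ≤ arcGain (η l) (Q.constraint (w l)) (α l) :=
  arcGain_nonneg (h.nonneg l) (h.step_mem_Ioc l).1.le

theorem mul_arcGain_le_dual_sub (h : Q.IsArmijoAscent αinit σ β η α w) (l : ℕ) :
    σ * arcGain (η l) (Q.constraint (w l)) (α l) ≤ Q.dual (η (l + 1)) - Q.dual (η l) :=
  h.update l ▸ (h.armijo l).1.2

theorem monotone_dual (h : Q.IsArmijoAscent αinit σ β η α w) : Monotone fun l => Q.dual (η l) :=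
  monotone_nat_of_le_succ fun l => sub_nonneg.1 <|
    (mul_nonneg h.σ_mem.1.le (h.arcGain_step_nonneg l)).trans (h.mul_arcGain_le_dual_sub l)

theorem exists_forall_mem_Icc (h : Q.IsArmijoAscent αinit σ β η α w) (hw₀ : w₀ ∈ Q.domain)
    (hneg : ∀ c, Q.constraint w₀ c < 0) : ∃ M, ∀ l, η l ∈ Set.Icc 0 M := by
  refine ⟨fun c => (Q.objective w₀ - Q.dual (η 0)) / -Q.constraint w₀ c,
    fun l => ⟨h.nonneg l, fun c => (le_div_of_constraint_neg (h.nonneg l) hw₀ hneg c).trans ?_⟩⟩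
  exact div_le_div_of_nonneg_right (sub_le_sub_left (h.monotone_dual l.zero_le) _)
    (neg_nonneg.2 (hneg c).le)

theorem tendsto_arcGain_step (h : Q.IsArmijoAscent αinit σ β η α w) (hw₀ : w₀ ∈ Q.feasibleSet) :
    Tendsto (fun l => arcGain (η l) (Q.constraint (w l)) (α l)) atTop (𝓝 0) := by
  have hlim := tendsto_atTop_ciSup h.monotone_dual
    ⟨Q.objective w₀, Set.forall_mem_range.2 fun l => dual_le_objective (h.nonneg l) hw₀⟩
  have hdiff : Tendsto (fun l => (Q.dual (η (l + 1)) - Q.dual (η l)) / σ) atTop (𝓝 0) := by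
    simpa using ((hlim.comp (tendsto_add_atTop_nat 1)).sub hlim).div_const σ
  refine squeeze_zero h.arcGain_step_nonneg (fun l => ?_) hdiff
  rw [le_div_iff₀' h.σ_mem.1]
  exact h.mul_arcGain_le_dual_sub l

variable {U : Ultrafilter ℕ} {ζ : ι → ℝ} {v : E}

theorem exists_arcGain_eq_zero_of_tendsto (h : Q.IsArmijoAscent αinit σ β η α w)
    (hw₀ : w₀ ∈ Q.feasibleSet) (hU : (U : Filter ℕ) ≤ atTop) (hη : Tendsto η U (𝓝 ζ))
    (hv : v ∈ Q.domain) (huniq : ∀ u, Q.IsLagrangianMin ζ u → u = v) :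
    ∃ t, 0 < t ∧ arcGain ζ (Q.constraint v) t = 0 := by
  have hw := tendsto_of_isLagrangianMin h.isLagrangianMin hη huniq
  obtain ⟨t, ht, hα : Tendsto α U (𝓝 t)⟩ := isCompact_Icc.ultrafilter_le_nhds (U.map α)
    (tendsto_principal.2 <| .of_forall fun l => Set.Ioc_subset_Icc_self (h.step_mem_Ioc l))
  rcases ht.1.eq_or_lt with rfl | htpos
  · have hαβ : Tendsto (fun l => α l / β) U (𝓝 0) := by simpa using hα.div_const β
    refine ⟨1, one_pos, arcGain_eq_zero_of_not_armijoTest hη h.nonneg hw hv huniq hαβ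
      (fun l => div_pos (h.step_mem_Ioc l).1 h.β_mem.1) h.σ_mem.2 one_pos ?_⟩
    filter_upwards [hα.eventually_lt_const h.αinit_pos] with l hl
    exact h.not_armijoTest_div hl
  · exact ⟨t, htpos, tendsto_nhds_unique (tendsto_arcGain hη (tendsto_constraint hw hv) hα)
      ((h.tendsto_arcGain_step hw₀).mono_left hU)⟩

theorem exists_isSolution_tendsto_ultrafilter (h : Q.IsArmijoAscent αinit σ β η α w)
    (hw₀ : w₀ ∈ Q.domain) (hneg : ∀ c, Q.constraint w₀ c < 0)
    (huniq : ∀ ζ, MapClusterPt ζ atTop η → ∃! v, Q.IsLagrangianMin ζ v)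
    (hU : (U : Filter ℕ) ≤ atTop) :
    ∃ v, Q.IsSolution v ∧ (∀ u, Q.IsSolution u → u = v) ∧ Tendsto w U (𝓝 v) := by
  obtain ⟨M, hM⟩ := h.exists_forall_mem_Icc hw₀ hneg
  obtain ⟨ζ, hζ, hη : Tendsto η U (𝓝 ζ)⟩ := isCompact_Icc.ultrafilter_le_nhds (U.map η)
    (tendsto_principal.2 (.of_forall hM))
  obtain ⟨v, hv, hvuniq⟩ := huniq ζ (mapClusterPt_iff_ultrafilter.2 ⟨U, hU, hη⟩)
  obtain ⟨t, ht, hgain⟩ :=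
    h.exists_arcGain_eq_zero_of_tendsto ⟨hw₀, fun c => (hneg c).le⟩ hU hη hv.1 hvuniq
  obtain ⟨hfeas, hcompl⟩ := nonpos_and_dotProduct_eq_zero_of_arcGain_eq_zero hζ.1 ht hgain
  exact ⟨v, hv.isSolution hζ.1 hfeas hcompl,
    fun u hu => hvuniq u (hu.isLagrangianMin hv hζ.1 hfeas hcompl),
    (tendsto_of_isLagrangianMin h.isLagrangianMin hη hvuniq).mono_right nhdsWithin_le_nhds⟩

end IsArmijoAscent

end CompactProgram

theorem proposition1_general {E ι : Type*} [TopologicalSpace E] [Fintype ι]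
    (Q : CompactProgram E ι) (hslater : ∃ w ∈ Q.domain, ∀ c, Q.constraint w c < 0)
    {αinit σ β : ℝ} {η : ℕ → ι → ℝ} {α : ℕ → ℝ} {w : ℕ → E}
    (hrun : Q.IsArmijoAscent αinit σ β η α w)
    (huniq : ∀ ζ, MapClusterPt ζ atTop η → ∃! v, Q.IsLagrangianMin ζ v) :
    ∃ wstar, Q.IsSolution wstar ∧ (∀ v, Q.IsSolution v → v = wstar) ∧
      Tendsto w atTop (𝓝 wstar) := by
  obtain ⟨w₀, hw₀, hneg⟩ := hslater
  obtain ⟨wstar, hsol, hstar, -⟩ := hrun.exists_isSolution_tendsto_ultrafilter hw₀ hneg huniq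
    (Ultrafilter.of_le atTop)
  refine ⟨wstar, hsol, hstar, (tendsto_iff_ultrafilter _ _ _).2 fun U hU => ?_⟩
  obtain ⟨v, hv, -, hlim⟩ :=
    hrun.exists_isSolution_tendsto_ultrafilter hw₀ hneg huniq hU
  exact hstar v hv ▸ hlim

namespace MVP

variable {N p q : ℕ} (P : MVP N p q)

theorem isCompact_W : IsCompact P.W :=
  isCompact_stdSimplex ℝ (Fin N)

theorem continuous_x : Continuous P.x :=
  continuous_pi fun _ => continuous_id.dotProduct continuous_const

theorem continuous_y : Continuous P.y :=
  continuous_pi fun _ => continuous_id.dotProduct (continuous_const.matrix_mulVec continuous_id)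

theorem continuous_g : Continuous P.g :=
  continuous_pi <| Sum.rec
    (fun i => continuous_const.sub ((continuous_apply i).comp P.continuous_x))
    (fun j => ((continuous_apply j).comp P.continuous_y).sub continuous_const)

theorem continuous_fTilde (wk : Fin N → ℝ) : Continuous (P.fTilde wk) :=
  (continuous_const.dotProduct P.continuous_x).add (continuous_const.dotProduct P.continuous_y)

/-- The convexified subproblem at the outer iterate `wk`, with only the mean-variance constraints
dualized. -/
noncomputable def subproblem (wk : Fin N → ℝ) : CompactProgram (Fin N → ℝ) (Fin p ⊕ Fin q) where
  domain := P.W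
  objective := P.fTilde wk
  constraint := P.g
  isCompact_domain := P.isCompact_W
  continuousOn_objective := (P.continuous_fTilde wk).continuousOn
  continuousOn_constraint := P.continuous_g.continuousOn

variable {P} {wk w : Fin N → ℝ} {η : Fin p ⊕ Fin q → ℝ}

theorem lagrangian_subproblem : (P.subproblem wk).lagrangian η w = P.lagrangian wk w η := by
  simp only [CompactProgram.lagrangian, subproblem, lagrangian, dotProduct, Fintype.sum_sum_type,
    g, Sum.elim_inl, Sum.elim_inr, mul_sub, Finset.sum_sub_distrib]
  ring

theorem dual_subproblem : (P.subproblem wk).dual η = P.dual wk η :=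
  congrArg sInf (Set.image_congr fun _ _ => lagrangian_subproblem)

theorem posPart_add_smul_g (t : ℝ) : (η + t • P.g w)⁺ = P.arc η w t :=
  funext fun _ => max_comm _ _

theorem armijoTest_subproblem {σ t : ℝ} :
    (P.subproblem wk).ArmijoTest σ η w t ↔ P.ArmijoTest wk σ η w t := by
  rw [CompactProgram.ArmijoTest, ArmijoTest, dual_subproblem, dual_subproblem, ge_iff_le, arcGain,
    ← posPart_add_smul_g]
  rfl

theorem lagrangian_subproblem_eq_qpObjective_add :
    (P.subproblem wk).lagrangian η w = P.qpObjective (P.lam wk) η w +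
      ((∑ i, η (Sum.inl i) * P.a i) - ∑ j, η (Sum.inr j) * P.b j) := by
  simp only [lagrangian_subproblem, lagrangian, qpObjective, fTilde, lam, dotProduct, Sum.elim_inl,
    Sum.elim_inr, mul_sub, add_mul, neg_mul, Finset.sum_sub_distrib, Finset.sum_add_distrib,
    Finset.sum_neg_distrib]
  ring

theorem isLagrangianMin_subproblem_iff :
    (P.subproblem wk).IsLagrangianMin η w ↔ P.IsQPSolution (P.lam wk) η w := by
  simp only [CompactProgram.IsLagrangianMin, IsQPSolution, isMinOn_iff,
    lagrangian_subproblem_eq_qpObjective_add, add_le_add_iff_right]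
  rfl

theorem feasibleSet_subproblem : (P.subproblem wk).feasibleSet = P.K := by
  ext w
  simp [CompactProgram.feasibleSet, subproblem, K, g, Pi.le_def]

theorem isSolution_subproblem_iff :
    (P.subproblem wk).IsSolution w ↔ P.IsSubproblemSolution wk w := by
  rw [CompactProgram.IsSolution, feasibleSet_subproblem]
  rfl

theorem IsStrictlyFeasible.g_neg (h : P.IsStrictlyFeasible w) : ∀ c, P.g w c < 0 :=
  Sum.rec (fun i => sub_neg.2 (h.2.1 i)) fun j => sub_neg.2 (h.2.2 j)

theorem IsInnerLoop.isArmijoAscent {αinit σ β : ℝ} {η : ℕ → Fin p ⊕ Fin q → ℝ} {α : ℕ → ℝ}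
    {wHat : ℕ → Fin N → ℝ} (h : P.IsInnerLoop wk αinit σ β η α wHat) (hαinit : 0 < αinit)
    (hσ : σ ∈ Set.Ioo (0 : ℝ) 1) (hβ : β ∈ Set.Ioo (0 : ℝ) 1) :
    (P.subproblem wk).IsArmijoAscent αinit σ β η α wHat where
  αinit_pos := hαinit
  σ_mem := hσ
  β_mem := hβ
  init := h.init
  isLagrangianMin l := isLagrangianMin_subproblem_iff.2 (h.qp l)
  armijo l := by simpa only [armijoTest_subproblem] using h.armijo l
  update l := (h.update l).trans (posPart_add_smul_g _).symm

end MVP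

theorem proposition1 {N p q : ℕ} (P : MVP N p q)
    (hS : ∀ j, (P.S j).PosDef)
    (hslater : ∃ w, P.IsStrictlyFeasible w)
    (hF : ∀ w ∈ P.K, DifferentiableAt ℝ P.F (P.x w, P.y w))
    (hA : P.RationalTradeoff)
    (wk : Fin N → ℝ) (hwk : wk ∈ P.K)
    (αinit σ β : ℝ) (hαinit : 0 < αinit) (hσ : σ ∈ Set.Ioo (0 : ℝ) 1) (hβ : β ∈ Set.Ioo (0 : ℝ) 1)
    (η : ℕ → Fin p ⊕ Fin q → ℝ) (α : ℕ → ℝ) (wHat : ℕ → Fin N → ℝ)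
    (hrun : P.IsInnerLoop wk αinit σ β η α wHat)
    -- the QP surrogate problem has a unique solution at every iterate and every limit of iterates
    (huniq : ∀ ζ ∈ closure (Set.range η), ∃! w, P.IsQPSolution (P.lam wk) ζ w) :
    ∃ wstar : Fin N → ℝ,
      P.IsSubproblemSolution wk wstar ∧
      (∀ v, P.IsSubproblemSolution wk v → v = wstar) ∧
      Tendsto wHat atTop (𝓝 wstar) := by
  simpa only [MVP.isSolution_subproblem_iff] using proposition1_general (P.subproblem wk)
    (hslater.imp fun _ h => ⟨h.1, h.g_neg⟩) (hrun.isArmijoAscent hαinit hσ hβ) fun ζ hζ => by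
      simpa only [MVP.isLagrangianMin_subproblem_iff] using
        huniq ζ (mem_closure_range_of_mapClusterPt hζ)
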